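/- Let $\Sigma$ be a closed connected orientable smooth surface with finitely many points removed. A \emph{train track} $\tau\subset\Sigma$ is a finite graph with trivalent vertices (switches), whose edges (branches) are $C^1$ arcs, embedded and pairwise disjoint away from their ends. At each switch the three incident half-branches share a tangent line, one of them (the \emph{large} one) leaving in one direction and the other two (the \emph{small} ones) in the opposite direction. For each component $R$ of $\Sigma\setminus\tau$, the double of $R$ along its boundary with the cusps removed has negative Euler characteristic. A \emph{measured train track} $(\tau,\mu)$ is a train track with a positive weight $\mu(b)$ for every branch $b$ such that at each switch $\mu(a)=\mu(b)+\mu(c)$, where $a$ is the large half-branch and $b,c$ are the small ones. A branch is \emph{large} if both of its ends are large half-branches. Let $e$ be a large branch with small half-branches $a$ (above) and $b$ (below) at its left end, and $c$ (above) and $d$ (below) at its right end, so that $\mu(a)+\mu(b)=\mu(e)=\mu(c)+\mu(d)$. If $\mu(a)\neq\mu(c)$, the \emph{splitting} of $(\tau,\mu)$ at $e$ changes $\tau$ only in a disc neighbourhood of $e$: there $e$ is removed, $a$ is joined to $c$ and $b$ to $d$ by two disjoint arcs, and a new branch $e'$ is inserted between these arcs. If $\mu(a)<\mu(c)$, then $e'$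 runs from $b$ to $c$, with weight $\mu(c)-\mu(a)$; if $\mu(c)<\mu(a)$, then $e'$ runs from $a$ to $d$, with weight $\mu(a)-\mu(c)$. All other branches persist, with their weights. If $\mu(a)=\mu(c)$ there is no splitting at $e$. A \emph{maximal splitting} $(\tau,\mu)\rightharpoonup(\tau',\mu')$ is the simultaneous splitting, in disjoint discs and up to isotopy, at all large branches whose weight is the maximum of $\mu$. Train tracks are considered up to isotopy, and a branch at which one does not split is regarded as the same branch after the splitting. A \emph{lamination} $\mathcal L\subset\Sigma$ is a closed set covered by flow boxes in which it is a union of horizontal segments, its leaves being immersed $C^1$ curves with continuously varying tangents. It is \emph{minimal} if every half-leaf is dense in $\mathcal L$. It is \emph{measured} if it carries a locally finite transverse measure of full support that is invariant under sliding along leaves. The measured lamination $\mathcal L$ is \emph{suited to} $(\tau,\mu)$ if there is a differentiable map $f:\Sigma\to\Sigma$, homotopic to the identity and non-singular on the tangent spaces to the leaves of $\mathcal L$, with $f(\mathcal L)=\tau$, such that for every branch $b$ and every interior point $x$ of $b$ the weight $\mu(b)$ is the total transverse measure of $\mathcal L\cap f^{-1}(x)$. \textbf{Lemma.} Let $\mathcal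 L$ be a minimal measured lamination suited to the measured train track $(\tau,\mu)=(\tau_0,\mu_0)$, let $e$ be any branch of $\tau$, and let $$(\tau_0,\mu_0)\rightharpoonup(\tau_1,\mu_1)\rightharpoonup\cdots\rightharpoonup(\tau_n,\mu_n)\rightharpoonup\cdots$$ be an infinite sequence of maximal splittings. Then there is an $n\ge 0$ such that $e$ is not split in the first $n$ steps (so that $e$ is still a branch of $\tau_n$) and the step $(\tau_n,\mu_n)\rightharpoonup(\tau_{n+1},\mu_{n+1})$ splits $e$; in particular $\mu_n(e)$ is the maximal weight of $\mu_n$. -/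

import Mathlib

open Set Topology Manifold MeasureTheory
open scoped ContDiff

noncomputable section

universe u

namespace TrainTrack

abbrev Plane : Type := EuclideanSpace ℝ (Fin 2)

/-! ### Surfaces -/

section Surface

variable (S : Type u) [TopologicalSpace S] [ChartedSpace Plane S]

/-- A smooth surface is orientable if it is covered by charts (of its maximal smooth atlas) all of
whose coordinate changes have positive Jacobian determinant. -/
def IsOrientable : Prop :=
  ∃ A ⊆ IsManifold.maximalAtlas (𝓡 2) ∞ S,
    (∀ p : S, ∃ φ ∈ A, p ∈ φ.source) ∧
    ∀ φ ∈ A, ∀ ψ ∈ A, ∀ x ∈ (φ.symm.trans ψ).source,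
      0 < (fderiv ℝ (φ.symm.trans ψ) x).det

/-- `S` is (diffeomorphic to) a closed connected orientable smooth surface minus finitely many
points. -/
def IsPuncturedClosedSurface : Prop :=
  ∃ (C : Type u) (_ : TopologicalSpace C) (_ : ChartedSpace Plane C),
    IsManifold (𝓡 2) ∞ C ∧ T2Space C ∧ CompactSpace C ∧ ConnectedSpace C ∧ IsOrientable C ∧
    ∃ ι : S → C, Function.Injective ι ∧ IsLocalDiffeomorph (𝓡 2) (𝓡 2) ∞ ι ∧ (range ι)ᶜ.Finite

/-- The Euler characteristic of a space, from singular homology with rational coefficients. -/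
def eulerChar (X : Type u) [TopologicalSpace X] : ℤ :=
  (((AlgebraicTopology.singularChainComplexFunctor (ModuleCat.{u} ℚ)).obj
    (ModuleCat.of ℚ (ULift.{u} ℚ))).obj (TopCat.of X)).homologyEulerChar

end Surface

/-- The rectangle `[-r, r] × [-1, 1]` in the plane. -/
def rect (r : ℝ) : Set Plane := {z | |z 0| ≤ r ∧ |z 1| ≤ 1}

variable {S : Type u} [TopologicalSpace S] [ChartedSpace Plane S]

/-- The part over `s` of the graph of `f`, drawn on the surface through the chart `φ`. -/
def arc (φ : OpenPartialHomeomorph S Plane) (f : ℝ → ℝ) (s : Set ℝ) : Set S :=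
  (fun x : ℝ => φ.symm !₂[x, f x]) '' s

/-! ### Train tracks -/

/-- A finite trivalent graph drawn on `S`. The branch `b` is parametrised by `curve b` on `[0, 1]`.
A half-branch is a branch with one of its two ends (`false` for the end at parameter `0`, `true` for
the end at parameter `1`). The three half-branches at a switch `v` are `half (v, i)`; the one with
`i = 0` is large, the ones with `i = 1, 2` are small. Every half-branch ends at exactly one
switch. -/
structure Graph (S : Type u) where
  Branch : Type
  Switch : Type
  finite_branch : Finite Branch
  finite_switch : Finite Switch
  curve : Branch → ℝ → S
  pos : Switch → S
  half : Switch × Fin 3 ≃ Branch × Bool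

namespace Graph

variable (G : Graph S)

def branchSet (b : G.Branch) : Set S := G.curve b '' Icc 0 1

def carrier : Set S := ⋃ b, G.branchSet b

/-- The branch underlying a half-branch, parametrised starting from the given end. -/
def path (h : G.Branch × Bool) (t : ℝ) : S :=
  if h.2 then G.curve h.1 (1 - t) else G.curve h.1 t

/-- The velocity with which a half-branch leaves its switch. -/
def exitVelocity (h : G.Branch × Bool) : Plane :=
  mfderivWithin 𝓘(ℝ, ℝ) (𝓡 2) (G.path h) (Icc 0 1) 0 (1 : ℝ)

/-- A branch is large if both of its ends are large half-branches. -/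
def IsLarge (b : G.Branch) : Prop := ∀ s : Bool, (G.half.symm (b, s)).2 = 0

/-- The cusp at the switch `v` lies in `R`: in some `C^1` chart around `v` the graph consists, near
`v`, of the graphs of two functions `lo ≤ up` that coincide exactly to the left of `v`, and the
points between the two graphs to the right of `v` belong to `R`. -/
def HasCuspIn (v : G.Switch) (R : Set S) : Prop :=
  ∃ φ ∈ IsManifold.maximalAtlas (𝓡 2) 1 S, ∃ lo up : ℝ → ℝ,
    rect 1 ⊆ φ.target ∧
    ContDiffOn ℝ 1 lo (Icc (-1) 1) ∧ ContDiffOn ℝ 1 up (Icc (-1) 1) ∧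
    (∀ x ∈ Icc (-1 : ℝ) 1, -1 < lo x ∧ lo x ≤ up x ∧ up x < 1 ∧ (lo x = up x ↔ x ≤ 0)) ∧
    G.carrier ∩ φ.symm '' rect 1 = arc φ lo (Icc (-1) 1) ∪ arc φ up (Icc (-1) 1) ∧
    G.pos v = φ.symm !₂[0, up 0] ∧
    ∀ x ∈ Ioc (0 : ℝ) 1, ∀ y ∈ Ioo (lo x) (up x), φ.symm !₂[x, y] ∈ R

end Graph

/-- A train track: the branches are immersed `C^1` arcs that are embedded and pairwise disjoint away
from their ends and end at the switches; at each switch the two small half-branches leave in the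
same direction, opposite to that of the large half-branch; and for each component `R` of the
complement, the double of `R` along its boundary with the cusps removed has negative Euler
characteristic. That Euler characteristic is twice the one of `R` minus the number of cusps of `R`,
because each cusp accounts for one (contractible) arc of the boundary with the cusps removed, and
the other components of this boundary are circles. -/
structure Track (S : Type u) [TopologicalSpace S] [ChartedSpace Plane S] extends Graph S where
  contMDiffOn_curve : ∀ b, ContMDiffOn 𝓘(ℝ, ℝ) (𝓡 2) 1 (curve b) (Icc 0 1)
  immersed : ∀ b, ∀ t ∈ Icc (0 : ℝ) 1,
    mfderivWithin 𝓘(ℝ, ℝ) (𝓡 2) (curve b) (Icc 0 1) t (1 : ℝ) ≠ 0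
  embedded : ∀ b b', ∀ t ∈ Ioo (0 : ℝ) 1, ∀ t' ∈ Ioo (0 : ℝ) 1,
    curve b t = curve b' t' → b = b' ∧ t = t'
  pos_injective : Function.Injective pos
  interior_ne_pos : ∀ b, ∀ t ∈ Ioo (0 : ℝ) 1, ∀ v, curve b t ≠ pos v
  path_zero : ∀ v i, toGraph.path (half (v, i)) 0 = pos v
  tangent : ∀ v, ∀ i : Fin 3, i ≠ 0 →
    SameRay ℝ (toGraph.exitVelocity (half (v, i))) (-toGraph.exitVelocity (half (v, 0)))
  euler_neg : ∀ p ∉ toGraph.carrier,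
    2 * eulerChar (connectedComponentIn toGraph.carrierᶜ p)
      - (({v | toGraph.HasCuspIn v (connectedComponentIn toGraph.carrierᶜ p)}.ncard : ℕ) : ℤ) < 0

/-- A measured train track: the weights are positive and, at each switch, the weight of the large
half-branch is the sum of the weights of the two small ones. -/
structure MTrack (S : Type u) [TopologicalSpace S] [ChartedSpace Plane S] extends Track S where
  weight : Branch → ℝ
  weight_pos : ∀ b, 0 < weight b
  weight_switch : ∀ v,
    weight (half (v, 0)).1 = weight (half (v, 1)).1 + weight (half (v, 2)).1

namespace MTrack

/-- The large branches of maximal weight. -/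
def maxBranches (T : MTrack S) : Set T.Branch :=
  {e | T.IsLarge e ∧ ∀ b, T.weight b ≤ T.weight e}

/-- In the chart `φ`, over the rectangle `[-3, 3] × [-1, 1]`, the track is the union of the graphs
of two `C^1` functions `lo ≤ up` that coincide exactly on `[-1, 1]`, and the branch `e` is the
common part of the two graphs. The half-branches `a` (upper left) and `b` (lower left) are the
small half-branches at the left end of `e`; `c` (upper right) and `d` (lower right) are those at its
right end. -/
structure IsLargeChart (T : MTrack S) (e : T.Branch) (φ : OpenPartialHomeomorph S Plane)
    (lo up : ℝ → ℝ) (a b c d : T.Branch × Bool) : Prop where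
  mem_atlas : φ ∈ IsManifold.maximalAtlas (𝓡 2) 1 S
  rect_subset : rect 3 ⊆ φ.target
  contDiffOn_lo : ContDiffOn ℝ 1 lo (Icc (-3) 3)
  contDiffOn_up : ContDiffOn ℝ 1 up (Icc (-3) 3)
  bounds : ∀ x ∈ Icc (-3 : ℝ) 3, -1 < lo x ∧ lo x ≤ up x ∧ up x < 1 ∧ (lo x = up x ↔ |x| ≤ 1)
  carrier_eq : T.carrier ∩ φ.symm '' rect 3 = arc φ lo (Icc (-3) 3) ∪ arc φ up (Icc (-3) 3)
  branch_eq : T.branchSet e = arc φ up (Icc (-1) 1)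
  incident : ∃ v w : T.Switch, v ≠ w ∧ (T.half (v, 0)).1 = e ∧ (T.half (w, 0)).1 = e ∧
    ({T.half (v, 1), T.half (v, 2)} : Set (T.Branch × Bool)) = {a, b} ∧
    ({T.half (w, 1), T.half (w, 2)} : Set (T.Branch × Bool)) = {c, d}
  arm_a : ∃ t ∈ Ioo (0 : ℝ) 1, T.path a '' Icc 0 t = arc φ up (Icc (-3) (-1))
  arm_b : ∃ t ∈ Ioo (0 : ℝ) 1, T.path b '' Icc 0 t = arc φ lo (Icc (-3) (-1))
  arm_c : ∃ t ∈ Ioo (0 : ℝ) 1, T.path c '' Icc 0 t = arc φ up (Icc 1 3)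
  arm_d : ∃ t ∈ Ioo (0 : ℝ) 1, T.path d '' Icc 0 t = arc φ lo (Icc 1 3)

/-- Over the rectangle in which `IsLargeChart` describes `T` around `e`, the track `T'` is the
result of splitting `e`: the upper half-branches `a`, `c` are joined by an arc (the graph of `up'`),
the lower ones `b`, `d` are joined by an arc below it (the graph of `lo'`), and the new branch `e'`
is a diagonal (the graph of `dg` over `[p, q]`) between the two arcs. If `μ(a) < μ(c)` then `e'` runs
from the lower left to the upper right and has weight `μ(c) - μ(a)`; if `μ(c) < μ(a)` then `e'` runs
from the upper left to the lower right and has weight `μ(a) - μ(c)`. The case `μ(a) = μ(c)` is not a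
splitting. -/
def IsLocalSplit (T T' : MTrack S) (φ : OpenPartialHomeomorph S Plane) (lo up : ℝ → ℝ)
    (a c : T.Branch × Bool) (e' : T'.Branch) : Prop :=
  ∃ (lo' up' dg : ℝ → ℝ) (p q : ℝ),
    ContDiffOn ℝ 1 lo' (Icc (-3) 3) ∧ ContDiffOn ℝ 1 up' (Icc (-3) 3) ∧
    (∀ x ∈ Icc (-3 : ℝ) 3, -1 < lo' x ∧ lo' x < up' x ∧ up' x < 1) ∧
    (∀ x ∈ Icc (-3 : ℝ) 3, 2 ≤ |x| → lo' x = lo x ∧ up' x = up x) ∧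
    -2 < p ∧ p < q ∧ q < 2 ∧
    ContDiffOn ℝ 1 dg (Icc p q) ∧ (∀ x ∈ Ioo p q, lo' x < dg x ∧ dg x < up' x) ∧
    T'.carrier ∩ φ.symm '' rect 3 =
      arc φ lo' (Icc (-3) 3) ∪ arc φ up' (Icc (-3) 3) ∪ arc φ dg (Icc p q) ∧
    T'.branchSet e' = arc φ dg (Icc p q) ∧
    ((T.weight a.1 < T.weight c.1 ∧ dg p = lo' p ∧ dg q = up' q ∧
        T'.weight e' = T.weight c.1 - T.weight a.1) ∨
      (T.weight c.1 < T.weight a.1 ∧ dg p = up' p ∧ dg q = lo' q ∧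
        T'.weight e' = T.weight a.1 - T.weight c.1))

/-- `T'` is obtained from `T` by splitting all the branches in `E`, inside disjoint disc
neighbourhoods of these branches. The bijection `β` matches a branch `e ∈ E` with the new branch
that replaces it, and every other branch with itself. -/
def IsSplit (T : MTrack S) (E : Set T.Branch) (T' : MTrack S) (β : T.Branch ≃ T'.Branch) : Prop :=
  ∃ φ : T.Branch → OpenPartialHomeomorph S Plane,
    (∀ e ∈ E, ∃ (lo up : ℝ → ℝ) (a b c d : T.Branch × Bool),
      T.IsLargeChart e (φ e) lo up a b c d ∧ IsLocalSplit T T' (φ e) lo up a c (β e)) ∧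
    E.PairwiseDisjoint (fun e => (φ e).symm '' rect 3) ∧
    ∀ x ∉ E, T'.weight (β x) = T.weight x ∧
      T'.branchSet (β x) \ (⋃ e ∈ E, (φ e).symm '' rect 2) =
        T.branchSet x \ (⋃ e ∈ E, (φ e).symm '' rect 2)

/-- An ambient `C^1` isotopy carries `T` to `T'`, matching branches by `ρ` and preserving weights. -/
def IsIsotopic (T T' : MTrack S) (ρ : T.Branch ≃ T'.Branch) : Prop :=
  ∃ H : ℝ → Diffeomorph (𝓡 2) (𝓡 2) S S 1,
    ContinuousOn (fun z : ℝ × S => H z.1 z.2) (Icc 0 1 ×ˢ univ) ∧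
    (∀ p, H 0 p = p) ∧
    ∀ b, T'.branchSet (ρ b) = H 1 '' T.branchSet b ∧ T'.weight (ρ b) = T.weight b

/-- The maximal splitting `T ⇀ T'`: up to isotopy, `T'` is obtained from `T` by splitting all large
branches of maximal weight, with induced matching `β` of branches. -/
def IsMaximalSplitting (T T' : MTrack S) (β : T.Branch ≃ T'.Branch) : Prop :=
  ∃ (T₁ : MTrack S) (β₁ : T.Branch ≃ T₁.Branch) (ρ : T₁.Branch ≃ T'.Branch),
    IsSplit T T.maxBranches T₁ β₁ ∧ IsIsotopic T₁ T' ρ ∧ β = β₁.trans ρ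

/-- The branch of `T n` that corresponds to the branch `e` of `T 0` under the matchings `β`. -/
def follow (T : ℕ → MTrack S) (β : ∀ n, (T n).Branch ≃ (T (n + 1)).Branch) (e : (T 0).Branch) :
    ∀ n, (T n).Branch
  | 0 => e
  | n + 1 => β n (follow T β e n)

end MTrack

/-! ### Laminations -/

/-- The velocity at `x` of the horizontal curve at height `y` of the flow box `φ`. -/
def leafVelocity (φ : OpenPartialHomeomorph S Plane) (x y : ℝ) :
    TangentSpace (𝓡 2) (φ.symm !₂[x, y]) :=
  mfderiv 𝓘(ℝ, ℝ) (𝓡 2) (fun s : ℝ => φ.symm !₂[s, y]) x (1 : ℝ)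

/-- A lamination: a closed set covered by flow boxes onto `(-1, 1) × (-1, 1)`, in each of which the
set is a union of horizontal segments (plaques); where two flow boxes overlap, their plaques agree
locally; the plaques are immersed `C^1` curves, with tangent vectors varying continuously. -/
structure Lamination (S : Type u) [TopologicalSpace S] [ChartedSpace Plane S]
    [IsManifold (𝓡 2) ∞ S] where
  carrier : Set S
  isClosed_carrier : IsClosed carrier
  boxes : Set (OpenPartialHomeomorph S Plane)
  target_eq : ∀ φ ∈ boxes, φ.target = {z | |z 0| < 1 ∧ |z 1| < 1}
  cover : ∀ p ∈ carrier, ∃ φ ∈ boxes, p ∈ φ.source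
  saturated : ∀ φ ∈ boxes, ∀ x ∈ Ioo (-1 : ℝ) 1, ∀ x' ∈ Ioo (-1 : ℝ) 1, ∀ y ∈ Ioo (-1 : ℝ) 1,
    φ.symm !₂[x, y] ∈ carrier → φ.symm !₂[x', y] ∈ carrier
  compatible : ∀ φ ∈ boxes, ∀ ψ ∈ boxes, ∀ p ∈ carrier ∩ φ.source ∩ ψ.source,
    ∃ W ∈ 𝓝 p, ∀ q ∈ W ∩ carrier, ∀ q' ∈ W ∩ carrier, φ q 1 = φ q' 1 → ψ q 1 = ψ q' 1
  contMDiffOn_plaque : ∀ φ ∈ boxes, ∀ y ∈ Ioo (-1 : ℝ) 1, φ.symm !₂[0, y] ∈ carrier →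
    ContMDiffOn 𝓘(ℝ, ℝ) (𝓡 2) 1 (fun x : ℝ => φ.symm !₂[x, y]) (Ioo (-1) 1)
  immersed : ∀ φ ∈ boxes, ∀ x ∈ Ioo (-1 : ℝ) 1, ∀ y ∈ Ioo (-1 : ℝ) 1,
    φ.symm !₂[x, y] ∈ carrier → leafVelocity φ x y ≠ 0
  continuousOn_velocity : ∀ φ ∈ boxes,
    ContinuousOn
      (fun z : ℝ × ℝ => (⟨φ.symm !₂[z.1, z.2], leafVelocity φ z.1 z.2⟩ : TangentBundle (𝓡 2) S))
      {z | z.1 ∈ Ioo (-1) 1 ∧ z.2 ∈ Ioo (-1) 1 ∧ φ.symm !₂[z.1, z.2] ∈ carrier}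

namespace Lamination

variable [IsManifold (𝓡 2) ∞ S]

/-- The leaf topology on a lamination, generated by the open subintervals of plaques. Its connected
components are the leaves. -/
@[reducible] def leafTopology (L : Lamination S) : TopologicalSpace L.carrier :=
  TopologicalSpace.generateFrom
    {P | ∃ φ ∈ L.boxes, ∃ y s t : ℝ,
      P = {p : L.carrier | (p : S) ∈ φ.source ∧ φ p 1 = y ∧ s < φ p 0 ∧ φ p 0 < t}}

/-- The leaf through a point. -/
def leaf (L : Lamination S) (p : L.carrier) : Set L.carrier :=
  @connectedComponent L.carrier L.leafTopology p

/-- A half-leaf: a connected component of a leaf minus a point `p` of it. (For a closed leaf, it is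
the whole leaf minus `p`.) -/
def IsHalfLeaf (L : Lamination S) (H : Set L.carrier) : Prop :=
  ∃ p, ∃ q ∈ L.leaf p, q ≠ p ∧
    H = @connectedComponentIn L.carrier L.leafTopology (L.leaf p \ {p}) q

/-- A lamination is minimal if every half-leaf is dense in it. -/
def IsMinimal (L : Lamination S) : Prop :=
  ∀ H, L.IsHalfLeaf H → L.carrier ⊆ closure (Subtype.val '' H)

/-- A transverse measure on `L`, given by a measure `m φ` on the vertical coordinate of each flow
box `φ`: it is locally finite, its support is exactly the set of heights of plaques of `L`, and it is
invariant under sliding along leaves: a Borel set in two flow boxes that is a transversal for both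
(it meets each plaque at most once) has the same measure in both. -/
structure TransverseMeasure (L : Lamination S) where
  m : OpenPartialHomeomorph S Plane → Measure ℝ
  locally_finite : ∀ φ ∈ L.boxes, ∀ r < 1, m φ (Icc (-r) r) < ⊤
  outside : ∀ φ ∈ L.boxes, m φ (Ioo (-1) 1)ᶜ = 0
  support : ∀ φ ∈ L.boxes, ∀ y ∈ Ioo (-1 : ℝ) 1,
    φ.symm !₂[0, y] ∈ L.carrier ↔ ∀ ε > 0, 0 < m φ (Ioo (y - ε) (y + ε))
  invariant : ∀ φ ∈ L.boxes, ∀ ψ ∈ L.boxes, ∀ A ⊆ L.carrier ∩ φ.source ∩ ψ.source,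
    MeasurableSet[borel S] A → InjOn (fun p => φ p 1) A → InjOn (fun p => ψ p 1) A →
    m φ ((fun p => φ p 1) '' A) = m ψ ((fun p => ψ p 1) '' A)

/-- `L` is suited to the graph `G` by means of `f`: `f` is a differentiable self-map of the surface,
homotopic to the identity, non-singular on the tangent spaces to the leaves, with `f(L) = G`. -/
structure IsSuitedBy (L : Lamination S) (G : Graph S) (f : C(S, S)) : Prop where
  homotopic : f.Homotopic (ContinuousMap.id S)
  mdifferentiable : MDifferentiable (𝓡 2) (𝓡 2) f
  image_eq : f '' L.carrier = G.carrier
  nonsingular : ∀ φ ∈ L.boxes, ∀ x ∈ Ioo (-1 : ℝ) 1, ∀ y ∈ Ioo (-1 : ℝ) 1,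
    φ.symm !₂[x, y] ∈ L.carrier →
    mfderiv (𝓡 2) (𝓡 2) f (φ.symm !₂[x, y]) (leafVelocity φ x y) ≠ 0

/-- The Borel set `A ⊆ L`, transverse to the leaves, has total transverse measure `w`: it is a
countable disjoint union of Borel sets, each a transversal of one flow box, with measures adding up
to `w`. -/
def TransverseMeasure.HasTotal {L : Lamination S} (M : L.TransverseMeasure) (A : Set S)
    (w : ENNReal) : Prop :=
  ∃ (φ : ℕ → OpenPartialHomeomorph S Plane) (B : ℕ → Set S),
    (∀ i, φ i ∈ L.boxes ∧ MeasurableSet[borel S] (B i) ∧ B i ⊆ (φ i).source ∧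
      InjOn (fun p => φ i p 1) (B i)) ∧
    Pairwise (fun i j => Disjoint (B i) (B j)) ∧
    ⋃ i, B i = A ∧
    w = ∑' i, M.m (φ i) ((fun p => φ i p 1) '' B i)

/-- The measured lamination `(L, M)` is suited to the measured train track `T`: `L` is suited to the
underlying train track by means of some `f`, and the weight of each branch is the transverse measure
of the part of `L` that `f` sends to a given interior point of the branch. -/
def IsSuited (L : Lamination S) (M : L.TransverseMeasure) (T : MTrack S) : Prop :=
  ∃ f : C(S, S), L.IsSuitedBy T.toGraph f ∧
    ∀ b, ∀ t ∈ Ioo (0 : ℝ) 1,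
      M.HasTotal (L.carrier ∩ f ⁻¹' {T.curve b t}) (ENNReal.ofReal (T.weight b))

end Lamination

end TrainTrack

end

/-!
The argument only involves weights. A branch of maximal weight is large, because a small half-branch
weighs less than the large half-branch at its switch (`MTrack.isLarge_of_forall_weight_le`). So a
maximal splitting changes exactly the weights of the heaviest branches, and it lowers each of them by
the sum of the weights of two small half-branches: if `μ(a) < μ(c)`, then
`μ(e') = μ(c) - μ(a) = μ(e) - μ(d) - μ(a)` (`MTrack.IsMaximalSplitting.weight_of_mem`).

Transporting all weights to the branches of the first track turns the sequence of splittings into a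
dynamical system of positive weights on a fixed finite set. If a branch `e` were never split, its
weight `m` would stay constant and bound the maximal weight from below. The total weight is
nonincreasing and positive, so the decrements tend to `0`; once they are below `m / 2`, every new
weight exceeds `m / 2`, so from then on all weights stay above some `δ > 0`. But then all decrements
are at least `δ`, a contradiction (`exists_isMax_of_maximal_subtraction`).
-/

open Filter

/-- Positive weights on a finite set evolve in discrete time: the weights that are maximal are
lowered by a sum of two weights, the others do not change. Then every element has maximal weight at
some time. -/
theorem exists_isMax_of_maximal_subtraction {B : Type*} [Finite B] (w : ℕ → B → ℝ)
    (pos : ∀ n x, 0 < w n x)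
    (step : ∀ n x, (∀ y, w n y ≤ w n x) → ∃ y z, w (n + 1) x = w n x - w n y - w n z)
    (keep : ∀ n x, ¬ (∀ y, w n y ≤ w n x) → w (n + 1) x = w n x) (e : B) :
    ∃ n, ∀ y, w n y ≤ w n e := by
  cases nonempty_fintype B
  by_contra hne
  have never (n : ℕ) : ¬ ∀ y, w n y ≤ w n e := fun h => hne ⟨n, h⟩
  have const (n : ℕ) : w n e = w 0 e := by
    induction n with
    | zero => rfl
    | succ n ih => rw [keep n e (never n), ih]
  have mono (n : ℕ) (x : B) : w (n + 1) x ≤ w n x := by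
    by_cases hx : ∀ y, w n y ≤ w n x
    · obtain ⟨y, z, h⟩ := step n x hx
      linarith [pos n y, pos n z]
    · exact (keep n x hx).le
  have anti : Antitone fun n => ∑ x, w n x :=
    antitone_nat_of_succ_le fun n => Finset.sum_le_sum fun x _ => mono n x
  have lim : Tendsto (fun n => ∑ x, w n x) atTop (𝓝 (⨅ n, ∑ x, w n x)) :=
    tendsto_atTop_ciInf anti
      ⟨0, by rintro _ ⟨n, rfl⟩; exact Finset.sum_nonneg fun x _ => (pos n x).le⟩
  have drop_lim (x : B) : Tendsto (fun n => w n x - w (n + 1) x) atTop (𝓝 0) := by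
    have h := lim.sub (lim.comp (tendsto_add_atTop_nat 1))
    rw [sub_self] at h
    refine squeeze_zero (fun n => sub_nonneg.2 (mono n x)) (fun n => ?_) h
    simp only [Function.comp_apply, ← Finset.sum_sub_distrib]
    exact Finset.single_le_sum (f := fun x => w n x - w (n + 1) x)
      (fun y _ => sub_nonneg.2 (mono n y)) (Finset.mem_univ x)
  have drop_lt (ε : ℝ) (hε : 0 < ε) : ∀ᶠ n in atTop, ∀ x, w n x - w (n + 1) x < ε :=
    eventually_all.2 fun x => (drop_lim x).eventually_lt_const hε
  obtain ⟨N, hN⟩ := eventually_atTop.1 (drop_lt (w 0 e / 2) (half_pos (pos 0 e)))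
  have : Nonempty B := ⟨e⟩
  obtain ⟨x₀, hx₀⟩ := Finite.exists_min (w N)
  set δ := min (w N x₀) (w 0 e / 2)
  have δ_pos : 0 < δ := lt_min (pos N x₀) (half_pos (pos 0 e))
  have lower (n : ℕ) (hn : N ≤ n) : ∀ x, δ ≤ w n x := by
    induction n, hn using Nat.le_induction with
    | base => exact fun x => (min_le_left _ _).trans (hx₀ x)
    | succ n hn ih =>
      intro x
      by_cases hx : ∀ y, w n y ≤ w n x
      · linarith [hN n hn x, hx e, const n, min_le_right (w N x₀) (w 0 e / 2)]
      · exact (keep n x hx).symm ▸ ih x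
  obtain ⟨n, hn, hn'⟩ := ((eventually_ge_atTop N).and (drop_lt δ δ_pos)).exists
  obtain ⟨x, hx⟩ := Finite.exists_max (w n)
  obtain ⟨y, z, h⟩ := step n x hx
  linarith [hn' x, lower n hn y, pos n z]

namespace TrainTrack.MTrack

variable {S : Type*} [TopologicalSpace S] [ChartedSpace Plane S]

theorem isLarge_of_forall_weight_le (T : MTrack S) {e : T.Branch}
    (he : ∀ b, T.weight b ≤ T.weight e) : T.IsLarge e := by
  intro s
  obtain ⟨⟨v, i⟩, hv⟩ := T.half.surjective (e, s)
  rw [← hv, Equiv.symm_apply_apply]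
  have h := T.weight_switch v
  have h0 := he (T.half (v, 0)).1
  have h1 := T.weight_pos (T.half (v, 1)).1
  have h2 := T.weight_pos (T.half (v, 2)).1
  have hi : T.weight (T.half (v, i)).1 = T.weight e := by rw [hv]
  fin_cases i
  · rfl
  · change T.weight (T.half (v, 1)).1 = _ at hi
    linarith
  · change T.weight (T.half (v, 2)).1 = _ at hi
    linarith

theorem mem_maxBranches_iff (T : MTrack S) {e : T.Branch} :
    e ∈ T.maxBranches ↔ ∀ b, T.weight b ≤ T.weight e :=
  ⟨fun h => h.2, fun h => ⟨T.isLarge_of_forall_weight_le h, h⟩⟩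

theorem weight_half_zero_of_pair_eq (T : MTrack S) {v : T.Switch} {a b : T.Branch × Bool}
    (h : ({T.half (v, 1), T.half (v, 2)} : Set (T.Branch × Bool)) = {a, b}) :
    T.weight (T.half (v, 0)).1 = T.weight a.1 + T.weight b.1 := by
  rw [T.weight_switch v]
  rcases Set.pair_eq_pair_iff.1 h with ⟨rfl, rfl⟩ | ⟨rfl, rfl⟩
  · rfl
  · exact add_comm _ _

theorem IsMaximalSplitting.weight_of_notMem {T T' : MTrack S} {β : T.Branch ≃ T'.Branch}
    (h : IsMaximalSplitting T T' β) {x : T.Branch} (hx : x ∉ T.maxBranches) :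
    T'.weight (β x) = T.weight x := by
  obtain ⟨T₁, β₁, ρ, ⟨φ, -, -, hkeep⟩, ⟨H, -, -, hρ⟩, rfl⟩ := h
  exact (hρ (β₁ x)).2.trans (hkeep x hx).1

/-- Each split branch loses the weights of two small half-branches, one at either of its ends. -/
theorem IsMaximalSplitting.weight_of_mem {T T' : MTrack S} {β : T.Branch ≃ T'.Branch}
    (h : IsMaximalSplitting T T' β) {x : T.Branch} (hx : x ∈ T.maxBranches) :
    ∃ y z, T'.weight (β x) = T.weight x - T.weight y - T.weight z := by
  obtain ⟨T₁, β₁, ρ, ⟨φ, hsplit, -, -⟩, ⟨H, -, -, hρ⟩, rfl⟩ := h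
  obtain ⟨lo, up, a, b, c, d, hchart, hlocal⟩ := hsplit x hx
  obtain ⟨v, v', -, hv, hv', hab, hcd⟩ := hchart.incident
  have h₁ := T.weight_half_zero_of_pair_eq hab
  have h₂ := T.weight_half_zero_of_pair_eq hcd
  rw [hv] at h₁
  rw [hv'] at h₂
  have h₃ : T'.weight (ρ (β₁ x)) = T₁.weight (β₁ x) := (hρ (β₁ x)).2
  obtain ⟨_, _, _, _, _, -, -, -, -, -, -, -, -, -, -, -, hw⟩ := hlocal
  rw [Equiv.trans_apply, h₃]
  rcases hw with ⟨-, -, -, hw⟩ | ⟨-, -, -, hw⟩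
  · exact ⟨d.1, a.1, by rw [hw]; linarith⟩
  · exact ⟨b.1, c.1, by rw [hw]; linarith⟩

theorem follow_surjective (T : ℕ → MTrack S) (β : ∀ n, (T n).Branch ≃ (T (n + 1)).Branch) (n : ℕ) :
    Function.Surjective fun e => follow T β e n := by
  induction n with
  | zero => exact Function.surjective_id
  | succ n ih => exact (β n).surjective.comp ih

/-- In an infinite sequence of maximal splittings, every branch is split at some step. -/
theorem exists_follow_mem_maxBranches (T : ℕ → MTrack S)
    (β : ∀ n, (T n).Branch ≃ (T (n + 1)).Branch)
    (hsplit : ∀ n, IsMaximalSplitting (T n) (T (n + 1)) (β n)) (e : (T 0).Branch) :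
    ∃ n, follow T β e n ∈ (T n).maxBranches := by
  have max_iff (n : ℕ) (x : (T 0).Branch) : follow T β x n ∈ (T n).maxBranches ↔
      ∀ y, (T n).weight (follow T β y n) ≤ (T n).weight (follow T β x n) := by
    rw [mem_maxBranches_iff, (follow_surjective T β n).forall]
  have := (T 0).finite_branch
  obtain ⟨n, hn⟩ := exists_isMax_of_maximal_subtraction
    (fun n x => (T n).weight (follow T β x n)) (fun n x => (T n).weight_pos _)
    (fun n x hx => by
      obtain ⟨y, z, h⟩ := (hsplit n).weight_of_mem ((max_iff n x).2 hx)
      obtain ⟨y, rfl⟩ := follow_surjective T β n y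
      obtain ⟨z, rfl⟩ := follow_surjective T β n z
      exact ⟨y, z, h⟩)
    (fun n x hx => (hsplit n).weight_of_notMem fun h => hx ((max_iff n x).1 h)) e
  exact ⟨n, (max_iff n e).2 hn⟩

end TrainTrack.MTrack

theorem mainTheorem8 {S : Type*} [TopologicalSpace S] [ChartedSpace TrainTrack.Plane S]
    [IsManifold (𝓡 2) ∞ S] (hS : TrainTrack.IsPuncturedClosedSurface S)
    (L : TrainTrack.Lamination S) (M : L.TransverseMeasure) (hmin : L.IsMinimal)
    (T : ℕ → TrainTrack.MTrack S) (hsuit : L.IsSuited M (T 0))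
    (β : ∀ n, (T n).Branch ≃ (T (n + 1)).Branch)
    (hsplit : ∀ n, TrainTrack.MTrack.IsMaximalSplitting (T n) (T (n + 1)) (β n))
    (e : (T 0).Branch) :
    ∃ n, (∀ k < n, TrainTrack.MTrack.follow T β e k ∉ (T k).maxBranches) ∧
      TrainTrack.MTrack.follow T β e n ∈ (T n).maxBranches ∧
      ∀ b, (T n).weight b ≤ (T n).weight (TrainTrack.MTrack.follow T β e n) := by
  classical
  have hex := TrainTrack.MTrack.exists_follow_mem_maxBranches T β hsplit e
  exact ⟨Nat.find hex, fun k hk => Nat.find_min hex hk, Nat.find_spec hex, (Nat.find_spec hex).2⟩
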